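/- Let $A$ be a finite-dimensional formally real Jordan algebra, that is, a finite-dimensional real vector space with a bilinear commutative product $\circ$ such that $(x\circ y)\circ(x\circ x)=x\circ(y\circ(x\circ x))$ for all $x,y\in A$, and such that $\sum_{i=1}^n x_i\circ x_i=0$ implies $x_1=\dots=x_n=0$. The positive cone $A_+$ is the set of all finite sums of squares $\sum_i x_i\circ x_i$. The trace $\mathrm{tr}(x)$ of $x\in A$ is the sum $\sum_i\mu_i$ of its eigenvalues, where $x=\sum_i\mu_i c_i$ with $\mu_i\in\mathbb{R}$ and with $c_i$ pairwise orthogonal primitive idempotents. The state space is $\mathcal S=\{x\in A_+ : \mathrm{tr}(x)=1\}$, and the pure states are the extreme points of $\mathcal S$. A spectrum of $x\in A_+$ is a vector $\lambda_1\ge\lambda_2\ge\dots\ge\lambda_n\ge 0$, with $n$ arbitrary, such that $x=\sum_{i=1}^n\lambda_i\sigma_i$ for some pure states $\sigma_1,\dots,\sigma_n$. The entropy of $x\in A_+$ is \[ H(x)=\inf\Bigl(-\sum_{i=1}^n\lambda_i\ln\lambda_i\Bigr), \] where the infimum is taken over all spectra of $x$ and $0\ln 0=0$. Theorem. For every $x\in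 A_+$ the infimum defining $H(x)$ is taken over a non-empty set that is bounded below, so that $H(x)$ is a well-defined real number, and the entropy function $H$ is a concave function on the convex set $A_+$: for all $x,y\in A_+$ and $t\in[0,1]$, \[ H\bigl((1-t)x+ty\bigr)\ \ge\ (1-t)H(x)+tH(y). \] -/

import Mathlib

noncomputable section

namespace JordanEntropy

variable {A : Type*} [NonUnitalNonAssocCommRing A] [Module ℝ A]

/-- A primitive idempotent: a nonzero idempotent that is not the sum of two nonzero idempotents
with product zero. -/
def IsPrimitiveIdempotent (c : A) : Prop :=
  c ≠ 0 ∧ IsIdempotentElem c ∧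
    ∀ a b : A, IsIdempotentElem a → IsIdempotentElem b → a * b = 0 → a + b = c → a = 0 ∨ b = 0

/-- `x = ∑ i, l i • c i` is a spectral decomposition of `x`: the `c i` are primitive idempotents
and are pairwise orthogonal; the `l i` are real numbers, the eigenvalues of `x` (apart from zeros,
which may be left out). -/
def IsSpectralDecomposition (x : A) (n : ℕ) (c : Fin n → A) (l : Fin n → ℝ) : Prop :=
  (∀ i, IsPrimitiveIdempotent (c i)) ∧ (∀ i j, i ≠ j → c i * c j = 0) ∧ x = ∑ i, l i • c i

open Classical in
/-- The (generic) trace of an element of a finite-dimensional formally real Jordan algebra: the sum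
of its eigenvalues, counted with multiplicity. Every element has a spectral decomposition and all of
them give the same sum; the value is read off from one of them. -/
def trace (x : A) : ℝ :=
  if h : ∃ t : ℝ, ∃ (n : ℕ) (c : Fin n → A) (l : Fin n → ℝ),
      IsSpectralDecomposition x n c l ∧ t = ∑ i, l i
  then h.choose else 0

variable (A) in
/-- The positive cone: the set of all sums of squares. -/
def positiveCone : Set A := {x | IsSumSq x}

variable (A) in
/-- The state space: the positive elements of trace one (density operators). -/
def stateSpace : Set A := {x | x ∈ positiveCone A ∧ trace x = 1}

variable (A) in
/-- The pure states: the extreme points of the state space. -/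
def pureStates : Set A := (stateSpace A).extremePoints ℝ

/-- `l 0 ≥ l 1 ≥ … ≥ l (n - 1) ≥ 0` is the spectrum of some decomposition of `x` into pure states.
The pure states are not required to be orthogonal and there is no restriction on `n`. -/
def IsSpectrum (x : A) (n : ℕ) (l : Fin n → ℝ) : Prop :=
  Antitone l ∧ (∀ i, 0 ≤ l i) ∧
    ∃ σ : Fin n → A, (∀ i, σ i ∈ pureStates A) ∧ x = ∑ i, l i • σ i

/-- The set of values `-∑ i, l i * log (l i)` (with `0 * log 0 = 0`) over all spectra of `x`. -/
def spectrumEntropies (x : A) : Set ℝ :=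
  {h | ∃ (n : ℕ) (l : Fin n → ℝ), IsSpectrum x n l ∧ h = -∑ i, l i * Real.log (l i)}

/-- The entropy of `x`: the infimum of `-∑ i, l i * log (l i)` over all spectra of `x`. -/
def entropy (x : A) : ℝ := sInf (spectrumEntropies x)

end JordanEntropy

end

/-! Write `η t = -t * log t` and `⟨x, y⟩ = trace (x * y)`. Every element is diagonal in some Jordan
frame, with nonnegative eigenvalues if it is positive, and the pure states are exactly the primitive
idempotents (`mem_pureStates_iff`).

The heart is that the eigenvalues attain the infimum (`isLeast_spectrumEntropies`). Let `∑ μ i • c i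
= ∑ l j • σ j` with `c` a frame and every `σ j` pure, and put `W i j = l j * (μ i)⁻¹ * ⟨c i, σ j⟩ ≥
0`. Pairing with `c i` gives `∑ j, W i j = 1` where `μ i ≠ 0`, and `∑ i, W i j * μ i = l j`. The
bound `∑ i, W i j ≤ 1` is the deeper one: if `z - t • s` is positive with `s` pure and `t > 0`, then
`t * ⟨z⁻¹, s⟩ ≤ 1` for the pseudo-inverse `z⁻¹` (`mul_sum_inv_le_one`). Jensen's inequality, with `η
0 = 0` absorbing the missing mass, yields `∑ η (μ i) ≤ ∑ η (l j)`.

Concavity then follows as for von Neumann entropy. For any frame `d` the matrix `⟨c i, d k⟩` is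
doubly stochastic, so the entropy of `x` is at most `∑ η ⟨x, d k⟩`, with equality if `d`
diagonalizes `x`. Take `d` diagonalizing the mixture and use concavity of `η` termwise.

The supporting structure theory is the Peirce decomposition, the spectral theorem, and an
associative, positive definite trace form. -/

open Polynomial

namespace JordanEntropy

/-! ### Polynomials without constant term, evaluated at one element -/

noncomputable section PolyEval

variable {A : Type*} [NonUnitalNonAssocCommRing A] [Module ℝ A] [SMulCommClass ℝ A A]

/-- The value at `x` of the polynomial `X * p`, which has no constant term. -/
def polyEval (x : A) (p : ℝ[X]) : A := aeval (LinearMap.mulLeft ℝ x) p x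

theorem polyEval_add (x : A) (p q : ℝ[X]) : polyEval x (p + q) = polyEval x p + polyEval x q := by
  simp [polyEval]

theorem polyEval_zero (x : A) : polyEval x 0 = 0 := by simp [polyEval]

theorem polyEval_one (x : A) : polyEval x 1 = x := by simp [polyEval]

theorem polyEval_C_mul (x : A) (a : ℝ) (p : ℝ[X]) : polyEval x (C a * p) = a • polyEval x p := by
  simp [polyEval, Algebra.algebraMap_eq_smul_one]

theorem polyEval_X_mul (x : A) (p : ℝ[X]) : polyEval x (X * p) = x * polyEval x p := by
  simp [polyEval]

theorem polyEval_sum {ι : Type*} (x : A) (s : Finset ι) (p : ι → ℝ[X]) :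
    polyEval x (∑ i ∈ s, p i) = ∑ i ∈ s, polyEval x (p i) := by
  simp [polyEval]

theorem polyEval_mem {x : A} {V : Submodule ℝ A} (hx : x ∈ V) (hV : ∀ v ∈ V, x * v ∈ V)
    (p : ℝ[X]) : polyEval x p ∈ V := by
  induction p using Polynomial.induction_on' with
  | add p q hp hq => rw [polyEval_add]; exact V.add_mem hp hq
  | monomial n a =>
    rw [← C_mul_X_pow_eq_monomial, polyEval_C_mul]
    refine V.smul_mem _ ?_
    induction n with
    | zero => simpa [polyEval_one] using hx
    | succ n ih => rw [pow_succ', polyEval_X_mul]; exact hV _ ih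

end PolyEval

/-! ### Linearized Jordan identity, Peirce spaces and power associativity -/

section Jordan

variable {A : Type*} [NonUnitalNonAssocCommRing A] [Module ℝ A] [IsCommJordan A]

theorem jordan_linearized (a b c d : A) :
    a * ((b * c) * d) + b * ((c * a) * d) + c * ((a * b) * d) =
      (b * c) * (a * d) + (c * a) * (b * d) + (a * b) * (c * d) := by
  have h : 2 • ((a * (b * c * d) - b * c * (a * d)) + (b * (c * a * d) - c * a * (b * d)) +
      (c * (a * b * d) - a * b * (c * d))) = 0 :=
    DFunLike.congr_fun (two_nsmul_lie_lmul_lmul_add_add_eq_zero a b c) d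
  have h2 : (2 : ℝ) • (a * ((b * c) * d) + b * ((c * a) * d) + c * ((a * b) * d) -
      ((b * c) * (a * d) + (c * a) * (b * d) + (a * b) * (c * d))) = 0 := by
    rw [← h]; module
  exact sub_eq_zero.1 ((smul_eq_zero.1 h2).resolve_left two_ne_zero)

/-! ### Peirce decomposition with respect to an idempotent -/

theorem peirce_cubic {c : A} (hc : c * c = c) (x : A) :
    (2 : ℝ) • (c * (c * (c * x))) = (3 : ℝ) • (c * (c * x)) - c * x := by
  have h := jordan_linearized x c c c
  simp only [hc, mul_comm x c] at h
  rw [mul_comm (c * x) c] at h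
  linear_combination (norm := module) h

theorem peirce_one_mul {c y : A} (hc : c * c = c) (hy : c * y = y) (z : A) :
    c * (y * z) = y * (c * z) := by
  have h := jordan_linearized c c y z
  rw [mul_comm y c, hc, hy] at h
  linear_combination (norm := module) h

theorem peirce_zero_mul {c y : A} (hc : c * c = c) (hy : c * y = 0) (z : A) :
    c * (y * z) = y * (c * z) := by
  have h := jordan_linearized c c y z
  rw [mul_comm y c, hc, hy] at h
  simp only [zero_mul, mul_zero, zero_add] at h
  exact h.symm

/-- Multiplication by `c` commutes with multiplication by `y` and by `z`, so `c * (y * z)` equals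
both `0` and `y * z`. -/
theorem peirce_one_mul_zero {c y z : A} (hc : c * c = c) (hy : c * y = y) (hz : c * z = 0) :
    y * z = 0 := by
  have h1 := peirce_one_mul hc hy z
  have h2 := peirce_zero_mul hc hz y
  rw [hz, mul_zero] at h1
  rw [hy, mul_comm z y, h1] at h2
  exact h2.symm

variable [IsScalarTower ℝ A A] [SMulCommClass ℝ A A]

theorem peirce_half_mul_half {c u v : A} (hc : c * c = c) (hu : c * u = (1 / 2 : ℝ) • u)
    (hv : c * v = (1 / 2 : ℝ) • v) : c * (c * (u * v)) = c * (u * v) := by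
  have h := jordan_linearized c u v c
  simp only [mul_comm v c, mul_comm u c, hu, hv, hc, smul_mul_assoc, mul_smul_comm,
    mul_comm (u * v) c, mul_comm v u] at h
  linear_combination (norm := module) h

theorem exists_peirce {c : A} (hc : c * c = c) (x : A) :
    ∃ x₁ u x₀ : A, x = x₁ + u + x₀ ∧ c * x₁ = x₁ ∧ c * u = (1 / 2 : ℝ) • u ∧ c * x₀ = 0 := by
  have h := peirce_cubic hc x
  -- `peirce_cubic` says that `L = mulLeft c` is a root of `T (T - 1) (2T - 1)`; the components are
  -- the Lagrange polynomials at `1`, `1/2`, `0` evaluated at `L`.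
  refine ⟨(2 : ℝ) • (c * (c * x)) - c * x, (4 : ℝ) • (c * x) - (4 : ℝ) • (c * (c * x)),
    x - (3 : ℝ) • (c * x) + (2 : ℝ) • (c * (c * x)), ?_, ?_, ?_, ?_⟩
  · module
  · simp only [mul_sub, mul_smul_comm]
    linear_combination (norm := module) h
  · simp only [mul_sub, mul_smul_comm]
    linear_combination (norm := module) (-2 : ℝ) • h
  · simp only [mul_sub, mul_add, mul_smul_comm]
    linear_combination (norm := module) h

/-! ### Polynomials in one element -/

theorem mulLeft_mul_mul (b c d : A) : LinearMap.mulLeft ℝ ((b * c) * d) =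
    LinearMap.mulLeft ℝ (b * c) * LinearMap.mulLeft ℝ d +
      LinearMap.mulLeft ℝ (b * d) * LinearMap.mulLeft ℝ c +
      LinearMap.mulLeft ℝ (c * d) * LinearMap.mulLeft ℝ b -
      LinearMap.mulLeft ℝ b * LinearMap.mulLeft ℝ d * LinearMap.mulLeft ℝ c -
      LinearMap.mulLeft ℝ c * LinearMap.mulLeft ℝ d * LinearMap.mulLeft ℝ b := by
  ext a
  have h := jordan_linearized a b c d
  simp only [LinearMap.sub_apply, LinearMap.add_apply, Module.End.mul_apply,
    LinearMap.mulLeft_apply]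
  rw [mul_comm (b * c * d) a, mul_comm d a, mul_comm (b * d), mul_comm (c * d), mul_comm d (c * a),
    mul_comm d (b * a), mul_comm b a]
  linear_combination (norm := module) h

/-- Two consecutive powers are carried through the induction because `mulLeft_mul_mul` expresses
multiplication by the next power through multiplications by `x`, `x * x` and the two preceding
powers. -/
theorem commute_mulLeft_polyEval_X_pow (x : A) (n : ℕ) :
    Commute (LinearMap.mulLeft ℝ x) (LinearMap.mulLeft ℝ (polyEval x (X ^ n))) ∧
    Commute (LinearMap.mulLeft ℝ x) (LinearMap.mulLeft ℝ (polyEval x (X ^ (n + 1)))) := by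
  have hsq : Commute (LinearMap.mulLeft ℝ x) (LinearMap.mulLeft ℝ (x * x)) := by
    ext y
    exact (IsJordan.lmul_lmul_comm_lmul x y).symm
  induction n with
  | zero => simpa [polyEval_one, pow_one, polyEval] using hsq
  | succ n ih =>
    refine ⟨ih.2, ?_⟩
    have h1 : polyEval x (X ^ (n + 1)) = x * polyEval x (X ^ n) := by
      rw [pow_succ', polyEval_X_mul]
    have h2 : polyEval x (X ^ (n + 1 + 1)) = (x * polyEval x (X ^ n)) * x := by
      rw [pow_succ', polyEval_X_mul, h1, mul_comm]
    rw [h2, mulLeft_mul_mul, mul_comm (polyEval x (X ^ n)) x, ← h1]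
    have hx := Commute.refl (LinearMap.mulLeft ℝ x)
    exact ((((ih.2.mul_right hx).add_right (hsq.mul_right ih.1)).add_right
      (ih.2.mul_right hx)).sub_right ((hx.mul_right hx).mul_right ih.1)).sub_right
      ((ih.1.mul_right hx).mul_right hx)

theorem commute_mulLeft_polyEval (x : A) (p : ℝ[X]) :
    Commute (LinearMap.mulLeft ℝ x) (LinearMap.mulLeft ℝ (polyEval x p)) := by
  induction p using Polynomial.induction_on' with
  | add p q hp hq =>
    have : LinearMap.mulLeft ℝ (polyEval x (p + q)) =
        LinearMap.mulLeft ℝ (polyEval x p) + LinearMap.mulLeft ℝ (polyEval x q) := by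
      ext y; simp [polyEval_add, add_mul]
    rw [this]
    exact hp.add_right hq
  | monomial n a =>
    have : LinearMap.mulLeft ℝ (polyEval x (monomial n a)) =
        a • LinearMap.mulLeft ℝ (polyEval x (X ^ n)) := by
      ext y; simp [← C_mul_X_pow_eq_monomial, polyEval_C_mul, smul_mul_assoc]
    rw [this]
    exact (commute_mulLeft_polyEval_X_pow x n).1.smul_right a

theorem polyEval_mul_polyEval (x : A) (p q : ℝ[X]) :
    polyEval x p * polyEval x q = polyEval x (X * p * q) := by
  have hcomm : Commute (LinearMap.mulLeft ℝ (polyEval x p)) (aeval (LinearMap.mulLeft ℝ x) q) :=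
    (Algebra.commute_of_mem_adjoin_singleton_of_commute (aeval_mem_adjoin_singleton ℝ _)
      (commute_mulLeft_polyEval x p).symm)
  calc polyEval x p * polyEval x q
      = (LinearMap.mulLeft ℝ (polyEval x p) * aeval (LinearMap.mulLeft ℝ x) q) x := rfl
    _ = (aeval (LinearMap.mulLeft ℝ x) q) (polyEval x p * x) := by rw [hcomm.eq]; rfl
    _ = polyEval x (X * p * q) := by
        rw [mul_comm (X * p) q, mul_comm _ x, ← polyEval_X_mul]
        simp [polyEval]

end Jordan

/-! ### Formal reality and the idempotents generated by one element -/

section Spectral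

variable {A : Type*} [NonUnitalNonAssocCommRing A] [IsFormallyReal A]

theorem eq_zero_of_mul_self {x : A} (h : x * x = 0) : x = 0 := by
  by_contra hx
  exact IsFormallyReal.not_isSumNonzeroSq_zero (h ▸ IsSumNonzeroSq.sq hx)

theorem eq_zero_of_mul_self_add {x y : A} (h : x * x + y * y = 0) : x = 0 :=
  eq_zero_of_mul_self (IsFormallyReal.eq_zero_of_add_right (IsSumSq.mul_self x)
    (IsSumSq.mul_self y) h)

variable [Module ℝ A] [IsScalarTower ℝ A A] [SMulCommClass ℝ A A] [IsCommJordan A]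

/-- The ideal of the polynomials `p` such that `X * p` vanishes at `x`. -/
def annIdeal (x : A) : Ideal ℝ[X] where
  carrier := {p | polyEval x p = 0}
  add_mem' {p q} hp hq := by
    simp only [Set.mem_ofPred_eq] at *
    rw [polyEval_add, hp, hq, add_zero]
  zero_mem' := polyEval_zero x
  smul_mem' p q hq := by
    simp only [Set.mem_ofPred_eq, smul_eq_mul] at *
    simp only [polyEval, map_mul, Module.End.mul_apply] at *
    rw [hq, map_zero]

theorem mem_annIdeal {x : A} {p : ℝ[X]} : p ∈ annIdeal x ↔ polyEval x p = 0 := Iff.rfl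

theorem mem_annIdeal_of_sq_mul {x : A} {q r : ℝ[X]} (h : q * q * r ∈ annIdeal x) :
    q * r ∈ annIdeal x := by
  refine mem_annIdeal.2 (eq_zero_of_mul_self ?_)
  rw [polyEval_mul_polyEval, ← mem_annIdeal,
    show X * (q * r) * (q * r) = (X * r) * (q * q * r) by ring]
  exact Ideal.mul_mem_left _ _ h

theorem mem_annIdeal_of_quadratic_mul {x : A} {r : ℝ[X]} {a b : ℝ} (hb : b ≠ 0)
    (h : ((X - C a) ^ 2 + C b ^ 2) * r ∈ annIdeal x) : r ∈ annIdeal x := by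
  have h0 : polyEval x (C b * r) = 0 := by
    refine eq_zero_of_mul_self_add (y := polyEval x ((X - C a) * r)) ?_
    rw [polyEval_mul_polyEval, polyEval_mul_polyEval, ← polyEval_add, ← mem_annIdeal,
      show X * (C b * r) * (C b * r) + X * ((X - C a) * r) * ((X - C a) * r) =
        (X * r) * (((X - C a) ^ 2 + C b ^ 2) * r) by ring]
    exact Ideal.mul_mem_left _ _ h
  rw [polyEval_C_mul] at h0
  exact (smul_eq_zero.1 h0).resolve_left hb

/-- Formal reality makes the generator of `annIdeal x` squarefree with only real roots: a repeated
factor would give a nonzero element of square zero, a nonreal root a nontrivial vanishing sum of two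
squares. -/
theorem exists_finset_nodal_mem_annIdeal [FiniteDimensional ℝ A] (x : A) :
    ∃ s : Finset ℝ, Lagrange.nodal s id ∈ annIdeal x := by
  obtain ⟨m, hm⟩ := IsPrincipalIdealRing.principal (annIdeal x)
  have hmem : ∀ p, p ∈ annIdeal x ↔ m ∣ p := fun p => by
    rw [hm]; exact Ideal.mem_span_singleton
  have hm0 : m ≠ 0 := by
    rintro rfl
    have h1 : minpoly ℝ (LinearMap.mulLeft ℝ x) ∈ annIdeal x := by
      rw [mem_annIdeal, polyEval, minpoly.aeval, LinearMap.zero_apply]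
    exact minpoly.ne_zero (Algebra.IsIntegral.isIntegral _) (zero_dvd_iff.1 ((hmem _).1 h1))
  have hsq : Squarefree m := by
    rintro q ⟨r, hr⟩
    have h1 : m ∣ q * r := (hmem _).1 (mem_annIdeal_of_sq_mul (hr ▸ (hmem m).2 dvd_rfl))
    have h2 : q * (q * r) ∣ 1 * (q * r) := by
      rwa [one_mul, ← mul_assoc, ← hr]
    have h3 : q * r ≠ 0 := by
      intro h; rw [mul_assoc, h, mul_zero] at hr; exact hm0 hr
    exact isUnit_of_dvd_one ((mul_dvd_mul_iff_right h3).1 h2)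
  have hreal : ∀ z : ℂ, aeval z m = 0 → z.im = 0 := by
    intro z hz
    by_contra him
    obtain ⟨r, hr⟩ := m.quadratic_dvd_of_aeval_eq_zero_im_ne_zero hz him
    have hq : (X ^ 2 - C (2 * z.re) * X + C (‖z‖ ^ 2) : ℝ[X]) = (X - C z.re) ^ 2 + C z.im ^ 2 := by
      rw [← Complex.normSq_eq_norm_sq, Complex.normSq_apply]
      simp only [map_mul, map_add, map_ofNat]
      ring
    rw [hq] at hr
    have h1 : m ∣ r := (hmem _).1 (mem_annIdeal_of_quadratic_mul him (hr ▸ (hmem m).2 dvd_rfl))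
    have h3 : r ≠ 0 := by
      rintro rfl; rw [mul_zero] at hr; exact hm0 hr
    have h2 : ((X - C z.re) ^ 2 + C z.im ^ 2) * r ∣ 1 * r := by rwa [one_mul, ← hr]
    have h4 := isUnit_of_dvd_one ((mul_dvd_mul_iff_right h3).1 h2)
    obtain ⟨k, hk, hk'⟩ := Polynomial.isUnit_iff.1 h4
    have h5 := congrArg (fun p => (aeval z) p) hk'
    have h6 : (z - z.re) ^ 2 + (z.im : ℂ) ^ 2 = 0 := by
      have : z - z.re = z.im * Complex.I := by
        apply Complex.ext <;> simp
      rw [this, mul_pow, Complex.I_sq]; ring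
    simp [h6] at h5
    exact hk.ne_zero h5
  have hsplit : m.Splits := by
    refine Splits.of_splits_map (algebraMap ℝ ℂ) (IsAlgClosed.splits _) fun z hz => ⟨z.re, ?_⟩
    have him := hreal z (by
      rw [aeval_def, eval₂_eq_eval_map]
      exact (mem_roots'.1 hz).2)
    apply Complex.ext <;> simp [him]
  refine ⟨m.roots.toFinset, (hmem _).2 ?_⟩
  have hnd : m.roots.Nodup := nodup_roots (PerfectField.separable_iff_squarefree.2 hsq)
  have h1 := hsplit.eq_prod_roots
  have h2 : Lagrange.nodal m.roots.toFinset id = (m.roots.map (X - C ·)).prod := by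
    rw [Lagrange.nodal_eq, Finset.prod, Multiset.toFinset_val, hnd.dedup]; rfl
  rw [h2]
  refine ⟨C m.leadingCoeff⁻¹, ?_⟩
  calc (m.roots.map (X - C ·)).prod
      = C (m.leadingCoeff * m.leadingCoeff⁻¹) * (m.roots.map (X - C ·)).prod := by
        rw [mul_inv_cancel₀ (leadingCoeff_ne_zero.2 hm0), C_1, one_mul]
    _ = C m.leadingCoeff * (m.roots.map (X - C ·)).prod * C m.leadingCoeff⁻¹ := by
        rw [C_mul]; ring
    _ = m * C m.leadingCoeff⁻¹ := by rw [← h1]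

/-- Modulo the annihilator only values on `s` matter, so the Lagrange basis supplies the
idempotents. The final clause keeps them inside any Peirce space of type `0` or `1` that contains
`x`. -/
theorem exists_idempotent_decomposition [FiniteDimensional ℝ A] (x : A) :
    ∃ (s : Finset ℝ) (e : ℝ → A), (∀ a ∈ s, e a * e a = e a) ∧
      (∀ a ∈ s, ∀ b ∈ s, a ≠ b → e a * e b = 0) ∧ x = ∑ a ∈ s, a • e a ∧
      ∀ V : Submodule ℝ A, x ∈ V → (∀ v ∈ V, x * v ∈ V) → ∀ a, e a ∈ V := by
  obtain ⟨s, hs⟩ := exists_finset_nodal_mem_annIdeal x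
  rcases s.eq_empty_or_nonempty with rfl | hne
  · refine ⟨∅, fun _ => 0, by simp, by simp, ?_, fun V _ _ _ => V.zero_mem⟩
    rw [Lagrange.nodal_empty, mem_annIdeal, polyEval_one] at hs
    simpa using hs
  have hinj : Set.InjOn (id : ℝ → ℝ) s := Function.injective_id.injOn
  have hvanish : ∀ p : ℝ[X], (∀ a ∈ s, p.eval a = 0) → polyEval x p = 0 := by
    intro p hp
    refine mem_annIdeal.1 (Ideal.mem_of_dvd _ ?_ hs)
    rw [Lagrange.nodal_eq]
    refine Finset.prod_dvd_of_coprime ?_ fun a ha => dvd_iff_isRoot.2 (hp a ha)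
    intro a _ b _ hab
    exact pairwise_coprime_X_sub_C Function.injective_id hab
  have heq : ∀ p q : ℝ[X], (∀ a ∈ s, p.eval a = q.eval a) → polyEval x p = polyEval x q := by
    intro p q hpq
    have h := hvanish (p - q) fun a ha => by rw [eval_sub, hpq a ha, sub_self]
    have h2 := polyEval_add x (p - q) q
    rwa [sub_add_cancel, h, zero_add] at h2
  let B : ℝ → ℝ[X] := fun a => Lagrange.basis s id a
  have hB : ∀ a ∈ s, (B a).eval a = 1 := fun a ha => Lagrange.eval_basis_self hinj ha
  have hB' : ∀ a, ∀ b ∈ s, a ≠ b → (B a).eval b = 0 := fun a b hb hab =>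
    Lagrange.eval_basis_of_ne (v := id) hab hb
  have hsq : ∀ a ∈ s, polyEval x (B a) * polyEval x (B a) = a • polyEval x (B a) := by
    intro a ha
    rw [polyEval_mul_polyEval, ← polyEval_C_mul]
    refine heq _ _ fun b hb => ?_
    by_cases hab : a = b
    · subst hab; simp [hB a ha]
    · simp [hB' a b hb hab]
  refine ⟨s, fun a => a⁻¹ • polyEval x (B a), ?_, ?_, ?_, ?_⟩
  · intro a ha
    by_cases h0 : a = 0
    · simp [h0]
    rw [smul_mul_smul_comm, hsq a ha, smul_smul, mul_assoc, inv_mul_cancel₀ h0, mul_one]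
  · intro a ha b hb hab
    rw [smul_mul_smul_comm, polyEval_mul_polyEval, hvanish, smul_zero]
    intro d hd
    by_cases had : a = d
    · subst had; simp [hB' b a hd hab.symm]
    · simp [hB' a d hd had]
  · have h1 : ∑ a ∈ s, B a = 1 := Lagrange.sum_basis hinj hne
    conv_lhs => rw [← polyEval_one x, ← h1, polyEval_sum]
    refine Finset.sum_congr rfl fun a ha => ?_
    -- At the root `0` the basis element has square zero, hence vanishes; this agrees with `0⁻¹ =
    -- 0`.
    by_cases h0 : a = 0
    · subst h0
      have := hsq 0 ha
      rw [zero_smul] at this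
      rw [eq_zero_of_mul_self this, zero_smul]
    · rw [smul_smul, mul_inv_cancel₀ h0, one_smul]
  · intro V hx hV a
    exact V.smul_mem _ (polyEval_mem hx hV _)

end Spectral

/-! ### Unit element, Jordan frames and the spectral theorem -/

section Frames

variable {A : Type*} [NonUnitalNonAssocCommRing A]

/-- A finite set of nonzero pairwise orthogonal idempotents. -/
def IsOrthogonalSet (F : Finset A) : Prop :=
  (∀ c ∈ F, c ≠ 0 ∧ c * c = c) ∧ ∀ c ∈ F, ∀ d ∈ F, c ≠ d → c * d = 0

theorem IsOrthogonalSet.sum_mul {F : Finset A} (hF : IsOrthogonalSet F) {c : A} (hc : c ∈ F) :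
    (∑ d ∈ F, d) * c = c := by
  rw [Finset.sum_mul, Finset.sum_eq_single c (fun d hd hdc => hF.2 d hd c hc hdc)
    (fun h => absurd hc h)]
  exact (hF.1 c hc).2

theorem IsOrthogonalSet.sum_mul_sum {F : Finset A} (hF : IsOrthogonalSet F) :
    (∑ d ∈ F, d) * (∑ d ∈ F, d) = ∑ d ∈ F, d := by
  rw [Finset.mul_sum]
  exact Finset.sum_congr rfl fun c hc => hF.sum_mul hc

theorem IsOrthogonalSet.insert [DecidableEq A] {F : Finset A} (hF : IsOrthogonalSet F) {a : A}
    (ha : a ≠ 0) (haa : a * a = a) (h : ∀ c ∈ F, a * c = 0) :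
    a ∉ F ∧ IsOrthogonalSet (insert a F) := by
  refine ⟨fun haF => ha (haa ▸ h a haF), ?_, ?_⟩
  · intro c hc
    rcases Finset.mem_insert.1 hc with rfl | hc
    · exact ⟨ha, haa⟩
    · exact hF.1 c hc
  · intro c hc d hd hcd
    rcases Finset.mem_insert.1 hc with hca | hc <;> rcases Finset.mem_insert.1 hd with hda | hd
    · exact absurd (hca.trans hda.symm) hcd
    · rw [hca]; exact h d hd
    · rw [hda, mul_comm]; exact h c hc
    · exact hF.2 c hc d hd hcd

theorem mul_eq_of_add_eq {a b c : A} (ha : a * a = a) (hab : a * b = 0) (h : a + b = c) :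
    c * a = a := by
  rw [← h, add_mul, ha, mul_comm b a, hab, add_zero]

variable [Module ℝ A] [IsScalarTower ℝ A A] [SMulCommClass ℝ A A]

theorem IsOrthogonalSet.card_le [FiniteDimensional ℝ A] {F : Finset A} (hF : IsOrthogonalSet F) :
    F.card ≤ Module.finrank ℝ A := by
  refine LinearIndependent.finset_card_le_finrank ?_
  rw [Fintype.linearIndependent_iff]
  intro g hg i
  have h := congrArg (fun x => x * (i : A)) hg
  simp only [Finset.sum_mul, zero_mul, smul_mul_assoc] at h
  rw [Finset.sum_eq_single i (fun j _ hj => by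
    rw [hF.2 j j.2 i i.2 (fun h => hj (Subtype.ext h)), smul_zero]) (by simp),
    (hF.1 i i.2).2] at h
  exact (smul_eq_zero.1 h).resolve_right (hF.1 i i.2).1

theorem exists_maximal_orthogonalSet [FiniteDimensional ℝ A] {P : Finset A → Prop}
    (hP : ∀ F, P F → IsOrthogonalSet F) (hne : ∃ F, P F) :
    ∃ F, P F ∧ ∀ G, P G → G.card ≤ F.card := by
  obtain ⟨F₀, hF₀⟩ := hne
  let S : Set ℕ := {n | ∃ F, P F ∧ F.card = n}
  have hb : BddAbove S := ⟨Module.finrank ℝ A, by rintro _ ⟨F, hF, rfl⟩; exact (hP F hF).card_le⟩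
  obtain ⟨F, hF, hn⟩ := Nat.sSup_mem (s := S) ⟨_, F₀, hF₀, rfl⟩ hb
  exact ⟨F, hF, fun G hG => hn ▸ le_csSup hb ⟨G, hG, rfl⟩⟩

variable [IsCommJordan A] [FiniteDimensional ℝ A] [IsFormallyReal A]

/-- The sum `e` of a largest orthogonal set of idempotents is the unit. A nonzero Peirce `0`-space
would contain another idempotent, and once it is trivial the half space vanishes too. -/
theorem exists_unit : ∃ e : A, ∀ x, e * x = x := by
  classical
  obtain ⟨F, hF, hmax⟩ := exists_maximal_orthogonalSet (A := A) (P := IsOrthogonalSet)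
    (fun _ h => h) ⟨∅, by simp [IsOrthogonalSet]⟩
  set e := ∑ d ∈ F, d with he
  have hee : e * e = e := hF.sum_mul_sum
  have hzero : ∀ x, e * x = 0 → x = 0 := by
    intro x hx
    obtain ⟨s, p, hp, -, hxp, hV⟩ := exists_idempotent_decomposition x
    have hep : ∀ a, e * p a = 0 := hV (LinearMap.ker (LinearMap.mulLeft ℝ e)) hx fun v hv => by
      rw [LinearMap.mem_ker, LinearMap.mulLeft_apply] at *
      rw [peirce_zero_mul hee hx, hv, mul_zero]
    have hp0 : ∀ a ∈ s, p a = 0 := by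
      intro a ha
      by_contra hpa
      have h := hF.insert hpa (hp a ha) fun c hc => by
        rw [mul_comm]
        exact peirce_one_mul_zero hee (hF.sum_mul hc) (hep a)
      have := hmax _ h.2
      rw [Finset.card_insert_of_notMem h.1] at this
      omega
    rw [hxp]
    exact Finset.sum_eq_zero fun a ha => by rw [hp0 a ha, smul_zero]
  -- As the `0`-space is trivial, `e` fixes `u * u`. The Jordan identity for `u` and `e` then gives
  -- `u * (u * u) = 0`, so the square of `u * u` vanishes.
  have hhalf : ∀ u, e * u = (1 / 2 : ℝ) • u → u = 0 := by
    intro u hu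
    have h1 : e * (u * u) = u * u := by
      have h2 := hzero (u * u - e * (u * u)) (by
        rw [mul_sub, peirce_half_mul_half hee hu hu, sub_self])
      exact (sub_eq_zero.1 h2).symm
    have h3 := IsCommJordan.lmul_comm_rmul_rmul u e
    rw [h1, mul_comm u e, hu, smul_mul_assoc] at h3
    have h4 : u * (u * u) = 0 := by
      have : (1 / 2 : ℝ) • (u * (u * u)) = 0 := by
        linear_combination (norm := module) -h3
      exact (smul_eq_zero.1 this).resolve_left (by norm_num)
    refine eq_zero_of_mul_self (eq_zero_of_mul_self ?_)
    rw [IsCommJordan.lmul_comm_rmul_rmul, h4, mul_zero]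
  refine ⟨e, fun x => ?_⟩
  obtain ⟨x₁, u, x₀, rfl, h1, h2, h3⟩ := exists_peirce hee x
  rw [hhalf u h2, hzero x₀ h3, add_zero, add_zero, h1]

variable (A) in
/-- The unit element of a finite-dimensional formally real Jordan algebra. -/
noncomputable def unit : A := (exists_unit (A := A)).choose

theorem unit_mul (x : A) : unit A * x = x := (exists_unit (A := A)).choose_spec x

/-- A Jordan frame: pairwise orthogonal primitive idempotents that sum to the unit element. -/
def IsFrame {n : ℕ} (c : Fin n → A) : Prop :=
  (∀ i, IsPrimitiveIdempotent (c i)) ∧ (∀ i j, i ≠ j → c i * c j = 0) ∧ ∑ i, c i = unit A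

/-- Splitting a nonprimitive member preserves the sum and the span condition but raises the
cardinality, so a largest such set is a frame. -/
theorem exists_isFrame_of_isOrthogonalSet {F₀ : Finset A} (hF₀ : IsOrthogonalSet F₀)
    (hsum₀ : ∑ d ∈ F₀, d = unit A) {x : A} (hx₀ : x ∈ Submodule.span ℝ (F₀ : Set A)) :
    ∃ (n : ℕ) (c : Fin n → A) (l : Fin n → ℝ), IsFrame c ∧ x = ∑ i, l i • c i := by
  classical
  obtain ⟨F, ⟨hF, hsum, hx⟩, hmax⟩ := exists_maximal_orthogonalSet (A := A)
    (P := fun F => IsOrthogonalSet F ∧ ∑ d ∈ F, d = unit A ∧ x ∈ Submodule.span ℝ (F : Set A))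
    (fun _ h => h.1) ⟨F₀, hF₀, hsum₀, hx₀⟩
  have hprim : ∀ c ∈ F, IsPrimitiveIdempotent c := by
    intro c hc
    refine ⟨(hF.1 c hc).1, (hF.1 c hc).2, ?_⟩
    intro a b ha hb hab habc
    by_contra! hne
    have hcc := (hF.1 c hc).2
    have hca : c * a = a := mul_eq_of_add_eq ha hab habc
    have hcb : c * b = b := mul_eq_of_add_eq hb (by rw [mul_comm, hab]) (by rw [add_comm, habc])
    have hE : IsOrthogonalSet (F.erase c) :=
      ⟨fun d hd => hF.1 d (Finset.mem_of_mem_erase hd), fun d hd d' hd' =>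
        hF.2 d (Finset.mem_of_mem_erase hd) d' (Finset.mem_of_mem_erase hd')⟩
    have hcd : ∀ d ∈ F.erase c, c * d = 0 := fun d hd =>
      hF.2 c hc d (Finset.mem_of_mem_erase hd) (Finset.ne_of_mem_erase hd).symm
    have h1 := hE.insert hne.2 hb fun d hd => peirce_one_mul_zero hcc hcb (hcd d hd)
    have h2 := h1.2.insert hne.1 ha fun d hd => by
      rcases Finset.mem_insert.1 hd with rfl | hd
      · exact hab
      · exact peirce_one_mul_zero hcc hca (hcd d hd)
    have h3 := hmax _ ⟨h2.2, by
      rw [Finset.sum_insert h2.1, Finset.sum_insert h1.1, ← add_assoc, habc,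
        Finset.add_sum_erase F (fun d => d) hc, hsum], by
      refine (Submodule.span_le.2 fun d hd => ?_) hx
      by_cases hdc : d = c
      · rw [hdc, ← habc]
        exact Submodule.add_mem _ (Submodule.subset_span (by simp))
          (Submodule.subset_span (by simp))
      · exact Submodule.subset_span (by simp [hdc, Finset.mem_coe.1 hd])⟩
    rw [Finset.card_insert_of_notMem h2.1, Finset.card_insert_of_notMem h1.1] at h3
    have := Finset.card_erase_add_one hc
    omega
  obtain ⟨f, hf⟩ := Submodule.mem_span_finset'.1 hx
  let φ := F.equivFin
  refine ⟨F.card, fun i => (φ.symm i : A), fun i => f (φ.symm i), ⟨fun i => hprim _ (φ.symm i).2,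
    fun i j hij => hF.2 _ (φ.symm i).2 _ (φ.symm j).2 fun h => hij (φ.symm.injective
      (Subtype.ext h)), ?_⟩, ?_⟩
  · rw [← hsum, Equiv.sum_comp φ.symm (fun d : F => (d : A)), Finset.sum_coe_sort F (fun d => d)]
  · rw [← hf, Equiv.sum_comp φ.symm (fun d : F => f d • (d : A))]

theorem exists_spectral_frame (x : A) :
    ∃ (n : ℕ) (c : Fin n → A) (l : Fin n → ℝ), IsFrame c ∧ x = ∑ i, l i • c i := by
  classical
  obtain ⟨s, p, hp, hpo, hxp, -⟩ := exists_idempotent_decomposition x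
  let F := (s.filter (p · ≠ 0)).image p
  have hF : IsOrthogonalSet F := by
    refine ⟨fun c hc => ?_, fun c hc d hd hcd => ?_⟩
    · obtain ⟨a, ha, rfl⟩ := Finset.mem_image.1 hc
      exact ⟨(Finset.mem_filter.1 ha).2, hp a (Finset.mem_filter.1 ha).1⟩
    · obtain ⟨a, ha, rfl⟩ := Finset.mem_image.1 hc
      obtain ⟨b, hb, rfl⟩ := Finset.mem_image.1 hd
      exact hpo a (Finset.mem_filter.1 ha).1 b (Finset.mem_filter.1 hb).1
        fun h => hcd (congrArg p h)
  have hx : x ∈ Submodule.span ℝ (F : Set A) := by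
    rw [hxp]
    refine Submodule.sum_mem _ fun a ha => Submodule.smul_mem _ _ ?_
    by_cases h : p a = 0
    · rw [h]; exact Submodule.zero_mem _
    · exact Submodule.subset_span (Finset.mem_coe.2 (Finset.mem_image_of_mem p
        (Finset.mem_filter.2 ⟨ha, h⟩)))
  -- If the spectral idempotents do not sum to the unit, the defect is one more idempotent
  -- orthogonal to them.
  by_cases hg : unit A - ∑ d ∈ F, d = 0
  · exact exists_isFrame_of_isOrthogonalSet hF (sub_eq_zero.1 hg).symm hx
  · have h := hF.insert hg (by
      rw [sub_mul, unit_mul, mul_sub, mul_comm _ (unit A), unit_mul, hF.sum_mul_sum]; abel)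
      fun c hc => by rw [sub_mul, unit_mul, hF.sum_mul hc, sub_self]
    refine exists_isFrame_of_isOrthogonalSet h.2 ?_ (Submodule.span_mono (by simp) hx)
    rw [Finset.sum_insert h.1, sub_add_cancel]

end Frames

/-! ### Coefficients along primitive idempotents; the trace form and its positivity -/

section Coef

variable {A : Type*} [NonUnitalNonAssocCommRing A] [Module ℝ A]

open Classical in
/-- The coefficient of a primitive idempotent `c` in the Peirce `1`-component of `x`. -/
noncomputable def coef (c x : A) : ℝ :=
  if h : ∃ r : ℝ, (2 : ℝ) • (c * (c * x)) - c * x = r • c then h.choose else 0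

variable [SMulCommClass ℝ A A]

theorem coef_eq {c x u v : A} {r : ℝ} (hc : IsPrimitiveIdempotent c) (hx : x = r • c + u + v)
    (hu : c * u = (1 / 2 : ℝ) • u) (hv : c * v = 0) : coef c x = r := by
  have hcc : c * c = c := hc.2.1
  have h : (2 : ℝ) • (c * (c * x)) - c * x = r • c := by
    simp only [hx, mul_add, mul_smul_comm, hcc, hu, hv, mul_zero]
    module
  have hex : ∃ r : ℝ, (2 : ℝ) • (c * (c * x)) - c * x = r • c := ⟨r, h⟩
  rw [coef, dif_pos hex]
  exact smul_left_injective ℝ hc.1 (hex.choose_spec.symm.trans h)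

theorem coef_self {c : A} (hc : IsPrimitiveIdempotent c) : coef c c = 1 :=
  coef_eq (u := 0) (v := 0) hc (by simp) (by simp) (by simp)

theorem coef_half {c u : A} (hc : IsPrimitiveIdempotent c) (hu : c * u = (1 / 2 : ℝ) • u) :
    coef c u = 0 :=
  coef_eq (v := 0) hc (by simp) hu (by simp)

theorem coef_zero_space {c v : A} (hc : IsPrimitiveIdempotent c) (hv : c * v = 0) :
    coef c v = 0 :=
  coef_eq (u := 0) hc (by simp) (by simp) hv

variable [IsScalarTower ℝ A A]

theorem sum_smul_mul {n : ℕ} {c : Fin n → A} (hc : ∀ i, IsPrimitiveIdempotent (c i))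
    (ho : ∀ i j, i ≠ j → c i * c j = 0) (l : Fin n → ℝ) (i : Fin n) :
    (∑ j, l j • c j) * c i = l i • c i := by
  rw [Finset.sum_mul, Finset.sum_eq_single i (fun j _ hj => by
    rw [smul_mul_assoc, ho j i hj, smul_zero]) (by simp), smul_mul_assoc, (hc i).2.1]

theorem sum_smul_mul_sum {n : ℕ} {c : Fin n → A} (hc : ∀ i, IsPrimitiveIdempotent (c i))
    (ho : ∀ i j, i ≠ j → c i * c j = 0) (l m : Fin n → ℝ) :
    (∑ i, l i • c i) * (∑ i, m i • c i) = ∑ i, (l i * m i) • c i := by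
  rw [Finset.mul_sum]
  exact Finset.sum_congr rfl fun i _ => by
    rw [mul_smul_comm, sum_smul_mul hc ho, smul_smul, mul_comm]

variable [IsCommJordan A]

variable [FiniteDimensional ℝ A] [IsFormallyReal A]

/-- A spectral idempotent `p` of `y` stays in the Peirce `1`-space, so `c = p + (c - p)` is an
orthogonal splitting and primitivity leaves only `p = 0` or `p = c`. -/
theorem exists_eq_smul_of_mul_eq {c y : A} (hc : IsPrimitiveIdempotent c) (hy : c * y = y) :
    ∃ r : ℝ, y = r • c := by
  have hcc : c * c = c := hc.2.1
  obtain ⟨s, p, hp, -, hyp, hV⟩ := exists_idempotent_decomposition y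
  have hcp : ∀ a, c * p a = p a := fun a => hV
    (LinearMap.eqLocus (LinearMap.mulLeft ℝ c) LinearMap.id) hy (fun v hv => by
      rw [LinearMap.mem_eqLocus, LinearMap.mulLeft_apply, LinearMap.id_apply] at *
      rw [peirce_one_mul hcc hy, hv]) a
  have hmem : y ∈ Submodule.span ℝ {c} := by
    rw [hyp]
    refine Submodule.sum_mem _ fun a ha => Submodule.smul_mem _ _ ?_
    have hca := hcp a
    have hac : p a * c = p a := by rw [mul_comm, hca]
    rcases hc.2.2 (p a) (c - p a) (hp a ha) (by
      rw [IsIdempotentElem, sub_mul, mul_sub, mul_sub, hcc, hca, hac, hp a ha]; abel)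
      (by rw [mul_sub, hac, hp a ha, sub_self]) (by abel) with h | h
    · rw [h]; exact Submodule.zero_mem _
    · rw [← sub_eq_zero.1 h]; exact Submodule.mem_span_singleton_self c
  obtain ⟨r, hr⟩ := Submodule.mem_span_singleton.1 hmem
  exact ⟨r, hr.symm⟩

theorem coef_spec {c : A} (hc : IsPrimitiveIdempotent c) (x : A) :
    ∃ u v : A, x = coef c x • c + u + v ∧ c * u = (1 / 2 : ℝ) • u ∧ c * v = 0 := by
  obtain ⟨x₁, u, v, hx, h1, hu, hv⟩ := exists_peirce hc.2.1 x
  obtain ⟨r, rfl⟩ := exists_eq_smul_of_mul_eq hc h1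
  exact ⟨u, v, by rwa [coef_eq hc hx hu hv], hu, hv⟩

theorem coef_quadratic {c : A} (hc : IsPrimitiveIdempotent c) (x : A) :
    (2 : ℝ) • (c * (c * x)) - c * x = coef c x • c := by
  obtain ⟨u, v, hx, hu, hv⟩ := coef_spec hc x
  have hcc : c * c = c := hc.2.1
  generalize coef c x = r at *
  simp only [hx, mul_add, mul_smul_comm, hcc, hu, hv, mul_zero]
  module

theorem coef_add {c : A} (hc : IsPrimitiveIdempotent c) (x y : A) :
    coef c (x + y) = coef c x + coef c y := by
  obtain ⟨u, v, hx, hu, hv⟩ := coef_spec hc x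
  obtain ⟨u', v', hy, hu', hv'⟩ := coef_spec hc y
  refine coef_eq (u := u + u') (v := v + v') hc ?_ (by rw [mul_add, hu, hu', smul_add])
    (by rw [mul_add, hv, hv', add_zero])
  conv_lhs => rw [hx, hy]
  module

theorem coef_smul {c : A} (hc : IsPrimitiveIdempotent c) (a : ℝ) (x : A) :
    coef c (a • x) = a * coef c x := by
  obtain ⟨u, v, hx, hu, hv⟩ := coef_spec hc x
  refine coef_eq (u := a • u) (v := a • v) hc ?_ (by rw [mul_smul_comm, hu, smul_comm])
    (by rw [mul_smul_comm, hv, smul_zero])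
  conv_lhs => rw [hx]
  module

/-- `coef c` as a linear functional. -/
noncomputable def coefLinear {c : A} (hc : IsPrimitiveIdempotent c) : A →ₗ[ℝ] ℝ where
  toFun := coef c
  map_add' := coef_add hc
  map_smul' := coef_smul hc

theorem coef_sum_smul {c : A} (hc : IsPrimitiveIdempotent c) {ι : Type*} (s : Finset ι) (l : ι → ℝ)
    (d : ι → A) : coef c (∑ i ∈ s, l i • d i) = ∑ i ∈ s, l i * coef c (d i) := by
  have h : coef c (∑ i ∈ s, l i • d i) = ∑ i ∈ s, coef c (l i • d i) :=
    map_sum (coefLinear hc) (fun i => l i • d i) s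
  simpa only [coef_smul hc] using h

/-- Compare the `c`-coefficients of `d * d = d` and of the Peirce `1`-component of `c` relative to
`d`. Exchanging `c` and `d` makes the squared difference of the two coefficients vanish, which is
the symmetry `coef_comm`. -/
theorem coef_mul_coef_eq_sq {c d : A} (hc : IsPrimitiveIdempotent c)
    (hd : IsPrimitiveIdempotent d) : coef d c * coef c d = coef c d ^ 2 := by
  have hcc : c * c = c := hc.2.1
  have hdd : d * d = d := hd.2.1
  obtain ⟨u, v, hx, hu, hv⟩ := coef_spec hc d
  set f := coef c d
  have huv : c * (u * v) = (1 / 2 : ℝ) • (u * v) := by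
    rw [mul_comm u v, peirce_zero_mul hcc hv, hu, mul_smul_comm]
  have hvv : c * (v * v) = 0 := by rw [peirce_zero_mul hcc hv, hv, mul_zero]
  have huc : u * c = (1 / 2 : ℝ) • u := by rw [mul_comm, hu]
  have hvc : v * c = 0 := by rw [mul_comm, hv]
  have h1 : d = f ^ 2 • c + f • u + u * u + (2 : ℝ) • (u * v) + v * v := by
    rw [← hdd, hx]
    simp only [add_mul, mul_add, smul_mul_assoc, mul_smul_comm, hcc, hu, hv, huc, hvc,
      mul_comm v u]
    module
  have h2 : f = f ^ 2 + coef c (u * u) := by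
    have := congrArg (coef c) h1
    simp only [coef_add hc, coef_smul hc, coef_self hc, coef_half hc hu, coef_half hc huv,
      coef_zero_space hc hvv] at this
    simpa using this
  have hdc : d * c = f • c + (1 / 2 : ℝ) • u := by
    rw [hx]
    simp only [add_mul, smul_mul_assoc, hcc, huc, hvc, add_zero]
  have h3 : coef d c • d = (2 * f ^ 2 - f) • c + (3 / 2 * f - 1 / 2) • u + u * u + u * v := by
    rw [← coef_quadratic hd c, hdc]
    conv_lhs => rw [hx]
    simp only [add_mul, mul_add, smul_mul_assoc, mul_smul_comm, hcc, hu, huc, hvc,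
      mul_comm v u]
    module
  have h4 := congrArg (coef c) h3
  simp only [coef_add hc, coef_smul hc, coef_self hc, coef_half hc hu, coef_half hc huv] at h4
  linarith

theorem coef_comm {c d : A} (hc : IsPrimitiveIdempotent c) (hd : IsPrimitiveIdempotent d) :
    coef c d = coef d c := by
  have h1 := coef_mul_coef_eq_sq hc hd
  have h2 := coef_mul_coef_eq_sq hd hc
  have : (coef c d - coef d c) ^ 2 = 0 := by linear_combination -h1 - h2
  exact sub_eq_zero.1 (pow_eq_zero_iff two_ne_zero |>.1 this)

theorem coef_unit {c : A} (hc : IsPrimitiveIdempotent c) : coef c (unit A) = 1 :=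
  coef_eq (u := 0) (v := unit A - c) hc (by module) (by simp)
    (by rw [mul_sub, mul_comm, unit_mul, hc.2.1, sub_self])

theorem IsFrame.sum_coef {n : ℕ} {c : Fin n → A} (hc : IsFrame c) {d : A}
    (hd : IsPrimitiveIdempotent d) : ∑ i, coef (c i) d = 1 := by
  calc ∑ i, coef (c i) d = ∑ i, 1 * coef d (c i) :=
        Finset.sum_congr rfl fun i _ => by rw [coef_comm (hc.1 i) hd, one_mul]
    _ = 1 := by rw [← coef_sum_smul hd]; simp only [one_smul]; rw [hc.2.2, coef_unit hd]

/-! ### The trace -/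

theorem exists_isFrame : ∃ (n : ℕ) (c : Fin n → A), IsFrame c := by
  obtain ⟨n, c, -, hc, -⟩ := exists_spectral_frame (0 : A)
  exact ⟨n, c, hc⟩

/-- By symmetry of `coef`, a primitive idempotent has total coefficient `1` along any frame. Hence
every spectral decomposition gives the same sum, and the trace is linear. -/
theorem IsFrame.trace_eq {n : ℕ} {c : Fin n → A} (hc : IsFrame c) (x : A) :
    trace x = ∑ i, coef (c i) x := by
  have hex : ∃ t : ℝ, ∃ (n : ℕ) (c : Fin n → A) (l : Fin n → ℝ),
      IsSpectralDecomposition x n c l ∧ t = ∑ i, l i := by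
    obtain ⟨m, d, l, hd, hx⟩ := exists_spectral_frame x
    exact ⟨_, m, d, l, ⟨hd.1, hd.2.1, hx⟩, rfl⟩
  rw [trace, dif_pos hex]
  obtain ⟨m, d, l, hd, ht⟩ := hex.choose_spec
  rw [ht]
  calc ∑ j, l j = ∑ j, l j * ∑ i, coef (c i) (d j) :=
        Finset.sum_congr rfl fun j _ => by rw [hc.sum_coef (hd.1 j), mul_one]
    _ = ∑ i, ∑ j, l j * coef (c i) (d j) := by simp only [Finset.mul_sum]; rw [Finset.sum_comm]
    _ = ∑ i, coef (c i) x := Finset.sum_congr rfl fun i _ => by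
        rw [← coef_sum_smul (hc.1 i), ← hd.2.2]

theorem trace_add (x y : A) : trace (x + y) = trace x + trace y := by
  obtain ⟨n, c, hc⟩ := exists_isFrame (A := A)
  simp only [hc.trace_eq, ← Finset.sum_add_distrib]
  exact Finset.sum_congr rfl fun i _ => coef_add (hc.1 i) x y

theorem trace_smul (a : ℝ) (x : A) : trace (a • x) = a * trace x := by
  obtain ⟨n, c, hc⟩ := exists_isFrame (A := A)
  simp only [hc.trace_eq, Finset.mul_sum]
  exact Finset.sum_congr rfl fun i _ => coef_smul (hc.1 i) a x

variable (A) in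
/-- The trace as a linear functional. -/
noncomputable def traceLinear : A →ₗ[ℝ] ℝ where
  toFun := trace
  map_add' := trace_add
  map_smul' := trace_smul

theorem trace_zero : trace (0 : A) = 0 := map_zero (traceLinear A)

theorem trace_sub (x y : A) : trace (x - y) = trace x - trace y := map_sub (traceLinear A) x y

theorem trace_sum {ι : Type*} (s : Finset ι) (x : ι → A) :
    trace (∑ i ∈ s, x i) = ∑ i ∈ s, trace (x i) := map_sum (traceLinear A) x s

theorem trace_primitive {c : A} (hc : IsPrimitiveIdempotent c) : trace c = 1 := by
  obtain ⟨n, d, hd⟩ := exists_isFrame (A := A)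
  rw [hd.trace_eq, hd.sum_coef hc]

/-- A frame diagonalizing `c` has eigenvalues `0` or `1` there, so its members operator-commute with
`c`. The component of `u` along such a member stays in the half space of `c`, which forces it to
vanish. -/
theorem trace_half {c u : A} (hc : c * c = c) (hu : c * u = (1 / 2 : ℝ) • u) : trace u = 0 := by
  obtain ⟨n, d, l, hd, hcd⟩ := exists_spectral_frame c
  have hmul : ∀ i, c * d i = l i • d i := fun i => by rw [hcd, sum_smul_mul hd.1 hd.2.1]
  rw [hd.trace_eq]
  refine Finset.sum_eq_zero fun i _ => ?_
  have hdi := (hd.1 i).2.1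
  have hl : l i = 0 ∨ l i = 1 := by
    have h1 : (∑ j, (l j * l j) • d j) * d i = c * d i := by
      rw [← sum_smul_mul_sum hd.1 hd.2.1, ← hcd, hc]
    rw [sum_smul_mul hd.1 hd.2.1, hmul] at h1
    have h2 : l i * l i = l i := smul_left_injective ℝ (hd.1 i).1 h1
    have h3 : l i * (l i - 1) = 0 := by linear_combination h2
    rcases mul_eq_zero.1 h3 with h | h
    · exact Or.inl h
    · exact Or.inr (sub_eq_zero.1 h)
  have hcomm : ∀ z, c * (d i * z) = d i * (c * z) := by
    intro z
    rcases hl with h | h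
    · exact peirce_zero_mul hc (by rw [hmul, h, zero_smul]) z
    · exact peirce_one_mul hc (by rw [hmul, h, one_smul]) z
  have h1 : c * (coef (d i) u • d i) = (1 / 2 : ℝ) • (coef (d i) u • d i) := by
    rw [← coef_quadratic (hd.1 i), mul_sub, mul_smul_comm, hcomm, hcomm, hu]
    simp only [mul_smul_comm]
    module
  rw [mul_smul_comm, hmul, smul_smul, smul_smul] at h1
  have h2 : coef (d i) u * l i = 1 / 2 * coef (d i) u := smul_left_injective ℝ (hd.1 i).1 h1
  rcases hl with h | h <;> rw [h] at h2 <;> linarith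

theorem trace_idempotent_mul_mul {c : A} (hc : c * c = c) (x z : A) :
    trace (c * x * z) = trace (x * (c * z)) := by
  obtain ⟨x₁, u, x₀, rfl, h1, hu, h0⟩ := exists_peirce hc x
  obtain ⟨z₁, w, z₀, rfl, k1, hw, k0⟩ := exists_peirce hc z
  have e1 : trace (x₁ * w) = 0 := trace_half hc (by rw [peirce_one_mul hc h1, hw, mul_smul_comm])
  have e2 : trace (z₁ * u) = 0 := trace_half hc (by rw [peirce_one_mul hc k1, hu, mul_smul_comm])
  have e3 : trace (x₀ * w) = 0 := trace_half hc (by rw [peirce_zero_mul hc h0, hw, mul_smul_comm])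
  have e4 : trace (z₀ * u) = 0 := trace_half hc (by rw [peirce_zero_mul hc k0, hu, mul_smul_comm])
  have e5 : x₁ * z₀ = 0 := peirce_one_mul_zero hc h1 k0
  have e6 : x₀ * z₁ = 0 := by rw [mul_comm]; exact peirce_one_mul_zero hc k1 h0
  simp only [mul_add, add_mul, h1, hu, h0, k1, hw, k0, smul_mul_assoc, mul_smul_comm, trace_add,
    trace_smul, mul_comm u z₁, mul_comm u z₀, e1, e2, e3, e4, e5, e6, trace_zero, mul_zero,
    zero_mul]
  ring

theorem trace_mul_mul (y x z : A) : trace (y * x * z) = trace (x * (y * z)) := by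
  obtain ⟨n, c, l, hc, rfl⟩ := exists_spectral_frame y
  simp only [Finset.sum_mul, Finset.mul_sum, smul_mul_assoc, mul_smul_comm, trace_sum, trace_smul]
  exact Finset.sum_congr rfl fun i _ => by rw [trace_idempotent_mul_mul (hc.1 i).2.1]

theorem trace_sum_mul_sum {n : ℕ} {c : Fin n → A} (hc : ∀ i, IsPrimitiveIdempotent (c i))
    (ho : ∀ i j, i ≠ j → c i * c j = 0) (l : Fin n → ℝ) :
    trace ((∑ i, l i • c i) * ∑ i, l i • c i) = ∑ i, l i ^ 2 := by
  rw [sum_smul_mul_sum hc ho, trace_sum]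
  exact Finset.sum_congr rfl fun i _ => by rw [trace_smul, trace_primitive (hc i), mul_one, sq]

theorem trace_mul_self_nonneg (x : A) : 0 ≤ trace (x * x) := by
  obtain ⟨n, c, l, hc, rfl⟩ := exists_spectral_frame x
  rw [trace_sum_mul_sum hc.1 hc.2.1]
  positivity

theorem eq_zero_of_trace_mul_self {x : A} (h : trace (x * x) = 0) : x = 0 := by
  obtain ⟨n, c, l, hc, rfl⟩ := exists_spectral_frame x
  rw [trace_sum_mul_sum hc.1 hc.2.1, Finset.sum_eq_zero_iff_of_nonneg fun i _ => sq_nonneg _] at h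
  exact Finset.sum_eq_zero fun i hi => by rw [pow_eq_zero_iff two_ne_zero |>.1 (h i hi), zero_smul]

/-- With Peirce components `y₁`, `u`, `y₀`, the trace is `trace (y₁ * y₁) + 1 / 2 * trace (u * u)`.
-/
theorem trace_idempotent_mul_sq {c : A} (hc : c * c = c) (y : A) :
    0 ≤ trace (c * (y * y)) ∧ (trace (c * (y * y)) = 0 → c * y = 0) := by
  have h0 : trace (c * (y * y)) = trace (c * y * y) := by
    rw [trace_mul_mul, mul_comm c, trace_mul_mul, mul_comm y c]
  obtain ⟨y₁, u, y₀, rfl, h1, hu, hv⟩ := exists_peirce hc y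
  have e1 : trace (y₁ * u) = 0 := trace_half hc (by rw [peirce_one_mul hc h1, hu, mul_smul_comm])
  have e2 : trace (y₀ * u) = 0 := trace_half hc (by rw [peirce_zero_mul hc hv, hu, mul_smul_comm])
  have e3 : y₁ * y₀ = 0 := peirce_one_mul_zero hc h1 hv
  have h2 : trace (c * (y₁ + u + y₀) * (y₁ + u + y₀)) =
      trace (y₁ * y₁) + 1 / 2 * trace (u * u) := by
    simp only [mul_add, add_mul, h1, hu, hv, smul_mul_assoc, trace_add, trace_smul,
      mul_comm u y₁, mul_comm u y₀, e1, e2, e3, trace_zero, zero_mul]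
    ring
  have p1 := trace_mul_self_nonneg y₁
  have p2 := trace_mul_self_nonneg u
  rw [h0, h2]
  refine ⟨by positivity, fun h => ?_⟩
  have q1 : y₁ = 0 := eq_zero_of_trace_mul_self (by linarith)
  have q2 : u = 0 := eq_zero_of_trace_mul_self (by linarith)
  simp [q1, q2, hv]

theorem trace_sq_mul_sq_nonneg (x y : A) : 0 ≤ trace (x * x * (y * y)) := by
  obtain ⟨n, c, l, hc, rfl⟩ := exists_spectral_frame x
  rw [sum_smul_mul_sum hc.1 hc.2.1, Finset.sum_mul, trace_sum]
  refine Finset.sum_nonneg fun i _ => ?_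
  rw [smul_mul_assoc, trace_smul]
  exact mul_nonneg (mul_self_nonneg _) (trace_idempotent_mul_sq (hc.1 i).2.1 y).1

theorem trace_mul_sq_nonneg {x : A} (hx : IsSumSq x) (y : A) : 0 ≤ trace (x * (y * y)) := by
  induction hx with
  | zero => rw [zero_mul, trace_zero]
  | sq_add a hs ih => rw [add_mul, trace_add]; exact add_nonneg (trace_sq_mul_sq_nonneg a y) ih

end Coef

/-! ### Pure states as primitive idempotents, and the weight bound -/

section PureStates

variable {A : Type*} [NonUnitalNonAssocCommRing A]

theorem IsPrimitiveIdempotent.isSumSq {c : A} (hc : IsPrimitiveIdempotent c) : IsSumSq c := by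
  rw [← hc.2.1]
  exact IsSumSq.mul_self c

variable [Module ℝ A] [IsScalarTower ℝ A A] [SMulCommClass ℝ A A]

theorem isSumSq_smul {a : ℝ} (ha : 0 ≤ a) {x : A} (hx : IsSumSq x) : IsSumSq (a • x) := by
  induction hx with
  | zero => rw [smul_zero]; exact IsSumSq.zero
  | sq_add y hs ih =>
    rw [smul_add]
    have h : a • (y * y) = (Real.sqrt a • y) * (Real.sqrt a • y) := by
      rw [smul_mul_smul_comm, Real.mul_self_sqrt ha]
    rw [h]
    exact IsSumSq.sq_add _ ih

theorem isSumSq_sum_smul {ι : Type*} {s : Finset ι} {l : ι → ℝ} {c : ι → A}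
    (hl : ∀ i ∈ s, 0 ≤ l i) (hc : ∀ i ∈ s, IsPrimitiveIdempotent (c i)) :
    IsSumSq (∑ i ∈ s, l i • c i) :=
  IsSumSq.sum fun i hi => isSumSq_smul (hl i hi) (hc i hi).isSumSq

theorem convex_positiveCone : Convex ℝ (positiveCone A) := fun _ hx _ hy _ _ ha hb _ =>
  IsSumSq.add (isSumSq_smul ha hx) (isSumSq_smul hb hy)

variable [IsCommJordan A] [FiniteDimensional ℝ A] [IsFormallyReal A]

theorem trace_mul_idempotent_nonneg {x p : A} (hx : IsSumSq x) (hp : p * p = p) :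
    0 ≤ trace (x * p) := by
  have h := trace_mul_sq_nonneg hx p
  rwa [hp] at h

theorem trace_sum_smul_mul {n : ℕ} {c : Fin n → A} (hc : IsFrame c) (l : Fin n → ℝ) (i : Fin n) :
    trace ((∑ j, l j • c j) * c i) = l i := by
  rw [sum_smul_mul hc.1 hc.2.1, trace_smul, trace_primitive (hc.1 i), mul_one]

theorem trace_sum_smul {n : ℕ} {c : Fin n → A} (hc : ∀ i, IsPrimitiveIdempotent (c i))
    (l : Fin n → ℝ) : trace (∑ i, l i • c i) = ∑ i, l i := by
  rw [trace_sum]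
  exact Finset.sum_congr rfl fun i _ => by rw [trace_smul, trace_primitive (hc i), mul_one]

theorem IsFrame.sum_trace_mul {n : ℕ} {c : Fin n → A} (hc : IsFrame c) {d : A}
    (hd : IsPrimitiveIdempotent d) : ∑ i, trace (c i * d) = 1 := by
  rw [← trace_sum, ← Finset.sum_mul, hc.2.2, unit_mul, trace_primitive hd]

theorem exists_nonneg_spectral_frame {x : A} (hx : IsSumSq x) :
    ∃ (n : ℕ) (c : Fin n → A) (l : Fin n → ℝ), IsFrame c ∧ (∀ i, 0 ≤ l i) ∧
      x = ∑ i, l i • c i := by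
  obtain ⟨n, c, l, hc, rfl⟩ := exists_spectral_frame x
  refine ⟨n, c, l, hc, fun i => ?_, rfl⟩
  rw [← trace_sum_smul_mul hc l i]
  exact trace_mul_idempotent_nonneg hx (hc.1 i).2.1

theorem mul_eq_zero_of_trace_mul_eq_zero {x p : A} (hx : IsSumSq x) (hp : p * p = p)
    (h : trace (x * p) = 0) : p * x = 0 := by
  obtain ⟨n, c, l, hc, hl, rfl⟩ := exists_nonneg_spectral_frame hx
  rw [Finset.sum_mul, trace_sum, Finset.sum_eq_zero_iff_of_nonneg fun i _ => by
    rw [smul_mul_assoc, trace_smul]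
    exact mul_nonneg (hl i) (trace_mul_idempotent_nonneg (hc.1 i).isSumSq hp)] at h
  rw [Finset.mul_sum]
  refine Finset.sum_eq_zero fun i hi => ?_
  have hi := h i hi
  rw [smul_mul_assoc, trace_smul] at hi
  rcases mul_eq_zero.1 hi with h0 | h0
  · rw [h0, zero_smul, mul_zero]
  · rw [mul_smul_comm, (trace_idempotent_mul_sq hp (c i)).2 (by rw [(hc.1 i).2.1, mul_comm, h0]),
      smul_zero]

theorem stateSpace_eq_convexHull :
    stateSpace A = convexHull ℝ {c : A | IsPrimitiveIdempotent c} := by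
  apply Set.Subset.antisymm
  · rintro x ⟨hx, ht⟩
    obtain ⟨n, c, l, hc, hl, rfl⟩ := exists_nonneg_spectral_frame hx
    rw [trace_sum_smul hc.1] at ht
    exact (convex_convexHull ℝ _).sum_mem (fun i _ => hl i) ht
      fun i _ => subset_convexHull ℝ _ (hc.1 i)
  · refine convexHull_min (fun c hc => ⟨hc.isSumSq, trace_primitive hc⟩) ?_
    rintro x ⟨hx, hx1⟩ y ⟨hy, hy1⟩ a b ha hb hab
    refine ⟨convex_positiveCone hx hy ha hb hab, ?_⟩
    rw [trace_add, trace_smul, trace_smul, hx1, hy1, mul_one, mul_one, hab]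

/-- For extremality, pair `c = s • a + t • b` with `unit A - c`: both terms are nonnegative and sum
to `0`, so `a` lies in the Peirce `1`-space of `c`, which is the line through `c`. -/
theorem mem_pureStates_iff {c : A} : c ∈ pureStates A ↔ IsPrimitiveIdempotent c := by
  refine ⟨fun h => ?_, fun hc => ?_⟩
  · rw [pureStates, stateSpace_eq_convexHull] at h
    have hc : c ∈ {c : A | IsPrimitiveIdempotent c} := extremePoints_convexHull_subset h
    exact hc
  refine ⟨⟨hc.isSumSq, trace_primitive hc⟩, ?_⟩
  rintro a ⟨ha, ha1⟩ b ⟨hb, hb1⟩ ⟨s, t, hs, ht, hst, habc⟩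
  have hcc : c * c = c := hc.2.1
  have hp : (unit A - c) * (unit A - c) = unit A - c := by
    rw [sub_mul, unit_mul, mul_sub, mul_comm c, unit_mul, hcc]; abel
  have h1 := trace_mul_idempotent_nonneg ha hp
  have h2 := trace_mul_idempotent_nonneg hb hp
  have h3 : s * trace (a * (unit A - c)) + t * trace (b * (unit A - c)) = 0 := by
    rw [← trace_smul, ← trace_smul, ← trace_add, ← smul_mul_assoc, ← smul_mul_assoc, ← add_mul,
      habc, mul_sub, mul_comm c, unit_mul, hcc, sub_self, trace_zero]
  have h4 : trace (a * (unit A - c)) = 0 := by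
    have := mul_nonneg ht.le h2
    have h5 := mul_nonneg hs.le h1
    exact (mul_eq_zero.1 (by linarith : s * trace (a * (unit A - c)) = 0)).resolve_left hs.ne'
  have h5 := mul_eq_zero_of_trace_mul_eq_zero ha hp h4
  rw [sub_mul, unit_mul, sub_eq_zero] at h5
  obtain ⟨r, rfl⟩ := exists_eq_smul_of_mul_eq hc h5.symm
  rw [trace_smul, trace_primitive hc, mul_one] at ha1
  rw [ha1, one_smul]

/-! ### The weight of a pure state below a positive element -/

theorem trace_mul_eq_coef {c : A} (hc : IsPrimitiveIdempotent c) (x : A) :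
    trace (c * x) = coef c x := by
  obtain ⟨u, v, hx, hu, hv⟩ := coef_spec hc x
  have hcc : c * c = c := hc.2.1
  conv_lhs => rw [hx]
  rw [mul_add, mul_add, mul_smul_comm, hcc, hu, hv, add_zero, trace_add, trace_smul, trace_smul,
    trace_primitive hc, trace_half hcc hu, mul_one, mul_zero, add_zero]

theorem trace_mul_mul_assoc (x y z : A) : trace (x * (y * z)) = trace (x * y * z) := by
  rw [mul_comm x y, trace_mul_mul]

/-- For a primitive idempotent `c` and `w = 2 a (a c) - a² c`, the quadratic operator of `a`
applied to `c`, this is `c a c a = ⟨c, a⟩ c a` in symmetrized form. -/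
theorem primitive_mul_quadratic {c : A} (hc : IsPrimitiveIdempotent c) (a : A) :
    c * ((2 : ℝ) • (a * (a * c)) - (a * a) * c) = coef c a • (a * c) := by
  obtain ⟨u, v, ha, hu, hv⟩ := coef_spec hc a
  have hcc : c * c = c := hc.2.1
  generalize coef c a = k at *
  have hq := peirce_half_mul_half hcc hu hu
  have huv : c * (u * v) = (1 / 2 : ℝ) • (u * v) := by
    rw [mul_comm u v, peirce_zero_mul hcc hv, hu, mul_smul_comm]
  have hvv : c * (v * v) = 0 := by rw [peirce_zero_mul hcc hv, hv, mul_zero]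
  have huc : u * c = (1 / 2 : ℝ) • u := by rw [mul_comm, hu]
  have hvc : v * c = 0 := by rw [mul_comm, hv]
  rw [mul_comm (a * a) c, ha]
  simp only [add_mul, mul_add, mul_sub, smul_mul_assoc, mul_smul_comm, hcc, hu, hv, huc, hvc,
    mul_comm v u, huv, hvv, hq, mul_zero, smul_zero]
  module

theorem sum_smul_mul_comm {n : ℕ} {c : Fin n → A} (hc : IsFrame c) (l m : Fin n → ℝ) (y : A) :
    (∑ i, l i • c i) * ((∑ i, m i • c i) * y) = (∑ i, m i • c i) * ((∑ i, l i • c i) * y) := by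
  simp only [Finset.sum_mul, Finset.mul_sum, smul_mul_assoc, mul_smul_comm,
    Finset.smul_sum]
  rw [Finset.sum_comm]
  refine Finset.sum_congr rfl fun i _ => Finset.sum_congr rfl fun j _ => ?_
  rw [smul_comm]
  by_cases hij : j = i
  · rw [hij]
  · rw [peirce_zero_mul (hc.1 j).2.1 (hc.2.1 j i hij)]

theorem trace_mul_eq_zero_of_isSumSq_sub {n : ℕ} {c : Fin n → A} (hc : IsFrame c)
    {l : Fin n → ℝ} {s : A} (hs : IsPrimitiveIdempotent s) {t : ℝ} (ht : 0 < t)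
    (h : IsSumSq (∑ i, l i • c i - t • s)) {i : Fin n} (hi : l i = 0) :
    trace (s * c i) = 0 := by
  have h1 := trace_mul_idempotent_nonneg h (hc.1 i).2.1
  have h2 := trace_mul_idempotent_nonneg hs.isSumSq (hc.1 i).2.1
  rw [sub_mul, trace_sub, trace_sum_smul_mul hc, hi, smul_mul_assoc, trace_smul] at h1
  nlinarith

/-- Here `a` is the pseudo-inverse of `z` and `k = ⟨a, s⟩`. Positivity of `z - t • s` is tested on
`w * w`, where `w` plays the role of the matrix product `a s a`. Since `z * w = a * s` and `s * w =
k • (a * s)`, this reads `(1 - t * k) * trace (a * s * w) ≥ 0`, and the last trace is positive when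
`k > 0`. -/
theorem mul_sum_inv_le_one {n : ℕ} {c : Fin n → A} (hc : IsFrame c)
    {l : Fin n → ℝ} {s : A} (hs : IsPrimitiveIdempotent s) {t : ℝ} (ht : 0 < t)
    (h : IsSumSq (∑ i, l i • c i - t • s)) :
    t * ∑ i, (l i)⁻¹ * trace (c i * s) ≤ 1 := by
  set z := ∑ i, l i • c i with hz
  set a := ∑ i, (l i)⁻¹ • c i with ha
  set e := ∑ i, (l i * (l i)⁻¹) • c i with he
  have hza : z * a = e := sum_smul_mul_sum hc.1 hc.2.1 _ _
  have hea : e * a = a := by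
    rw [he, ha, sum_smul_mul_sum hc.1 hc.2.1]
    refine Finset.sum_congr rfl fun i _ => ?_
    by_cases hi : l i = 0
    · rw [hi, inv_zero, mul_zero]
    · rw [mul_inv_cancel₀ hi, one_mul]
  -- The support idempotent `e` of `z` fixes `s`, because `s` is annihilated by every `c i` with
  -- eigenvalue `0`.
  have hes : e * s = s := by
    conv_rhs => rw [← unit_mul s, ← hc.2.2, Finset.sum_mul]
    rw [he, Finset.sum_mul]
    refine Finset.sum_congr rfl fun i _ => ?_
    by_cases hi : l i = 0
    · rw [mul_eq_zero_of_trace_mul_eq_zero hs.isSumSq (hc.1 i).2.1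
        (trace_mul_eq_zero_of_isSumSq_sub hc hs ht h hi), smul_mul_assoc,
        mul_eq_zero_of_trace_mul_eq_zero hs.isSumSq (hc.1 i).2.1
        (trace_mul_eq_zero_of_isSumSq_sub hc hs ht h hi), smul_zero]
    · rw [mul_inv_cancel₀ hi, one_smul]
  set w := (2 : ℝ) • (a * (a * s)) - (a * a) * s with hw
  have hzw : z * w = a * s := by
    have h1 := DFunLike.congr_fun (mulLeft_mul_mul z a a) s
    simp only [LinearMap.sub_apply, LinearMap.add_apply, Module.End.mul_apply,
      LinearMap.mulLeft_apply] at h1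
    have h2 : e * (a * s) = a * s := by rw [he, ha, sum_smul_mul_comm hc, ← he, hes]
    have h3 : a * a * (z * s) = z * (a * a * s) := by
      rw [ha, sum_smul_mul_sum hc.1 hc.2.1, hz, sum_smul_mul_comm hc]
    have h4 : a * (a * (z * s)) = z * (a * (a * s)) := by
      rw [ha, hz, sum_smul_mul_comm hc _ l s, sum_smul_mul_comm hc _ l]
    rw [hza, hea, h2, h3, h4] at h1
    rw [hw, mul_sub, mul_smul_comm]
    linear_combination (norm := module) h1
  have hk : ∑ i, (l i)⁻¹ * trace (c i * s) = coef s a := by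
    rw [← trace_mul_eq_coef hs, mul_comm s a, ha, Finset.sum_mul, trace_sum]
    exact Finset.sum_congr rfl fun i _ => by rw [smul_mul_assoc, trace_smul]
  rw [hk]
  have hsw : s * w = coef s a • (a * s) := primitive_mul_quadratic hs a
  set k := coef s a with hk'
  rcases le_or_gt k 0 with hk0 | hk0
  · nlinarith
  have h1 : trace (z * (w * w)) = trace (a * s * w) := by rw [trace_mul_mul_assoc, hzw]
  have h2 : trace (s * (w * w)) = k * trace (a * s * w) := by
    rw [trace_mul_mul_assoc, hsw, smul_mul_assoc, trace_smul]
  have h3 := trace_mul_sq_nonneg h w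
  rw [sub_mul, trace_sub, h1, smul_mul_assoc, trace_smul, h2] at h3
  have h4 := trace_idempotent_mul_sq hs.2.1 w
  have h5 : trace (s * (w * w)) ≠ 0 := by
    intro h0
    have h6 : trace (s * w) = k * k := by
      rw [hsw, trace_smul, mul_comm a s, trace_mul_eq_coef hs]
    rw [h4.2 h0, trace_zero] at h6
    nlinarith
  have h6 : 0 < k * trace (a * s * w) := h2 ▸ lt_of_le_of_ne h4.1 (Ne.symm h5)
  have h7 : 0 < trace (a * s * w) := pos_of_mul_pos_right h6 hk0.le
  by_contra! h8
  nlinarith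

end PureStates

/-! ### Minimality of the eigenvalue entropy, and concavity -/

section Entropy

/-- Jensen's inequality with the missing weight placed at `0`, where `negMulLog` vanishes; total
weight at most `1` therefore suffices. -/
theorem sum_mul_negMulLog_le {ι : Type*} {s : Finset ι} {w p : ι → ℝ} (hw : ∀ i ∈ s, 0 ≤ w i)
    (hw1 : ∑ i ∈ s, w i ≤ 1) (hp : ∀ i ∈ s, 0 ≤ p i) :
    ∑ i ∈ s, w i * Real.negMulLog (p i) ≤ Real.negMulLog (∑ i ∈ s, w i * p i) := by
  have h := Real.concaveOn_negMulLog.map_add_sum_le (v := 1 - ∑ i ∈ s, w i) (q := 0) hw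
    (sub_add_cancel _ _) hp (sub_nonneg.2 hw1) (Set.mem_Ici.2 le_rfl)
  simpa using h

variable {A : Type*} [NonUnitalNonAssocCommRing A] [Module ℝ A] [IsScalarTower ℝ A A]
  [SMulCommClass ℝ A A] [IsCommJordan A] [FiniteDimensional ℝ A] [IsFormallyReal A]

theorem trace_mul_nonneg_of_primitive {c d : A} (hc : IsPrimitiveIdempotent c)
    (hd : IsPrimitiveIdempotent d) : 0 ≤ trace (c * d) :=
  trace_mul_idempotent_nonneg hc.isSumSq hd.2.1

theorem sum_negMulLog_le_of_primitive_decomposition {n m : ℕ} {c : Fin n → A} (hc : IsFrame c)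
    {μ : Fin n → ℝ} (hμ : ∀ i, 0 ≤ μ i) {σ : Fin m → A} (hσ : ∀ j, IsPrimitiveIdempotent (σ j))
    {l : Fin m → ℝ} (hl : ∀ j, 0 ≤ l j) (h : ∑ i, μ i • c i = ∑ j, l j • σ j) :
    ∑ i, Real.negMulLog (μ i) ≤ ∑ j, Real.negMulLog (l j) := by
  classical
  have hsub : ∀ j, IsSumSq (∑ i, μ i • c i - l j • σ j) := by
    intro j
    rw [h, ← Finset.add_sum_erase _ _ (Finset.mem_univ j), add_sub_cancel_left]
    exact isSumSq_sum_smul (fun i _ => hl i) fun i _ => hσ i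
  -- For fixed `j` the weights have total at most `1` and average the `μ i` to `l j`. Where `μ i =
  -- 0`, the convention `0⁻¹ = 0` makes the weight zero.
  have hrow : ∀ j, ∑ i, (l j * (μ i)⁻¹ * trace (c i * σ j)) * Real.negMulLog (μ i) ≤
      Real.negMulLog (l j) := by
    intro j
    rcases (hl j).eq_or_lt with h0 | hpos
    · simp [← h0]
    have h1 : ∑ i, (l j * (μ i)⁻¹ * trace (c i * σ j)) * μ i = l j := by
      calc ∑ i, (l j * (μ i)⁻¹ * trace (c i * σ j)) * μ i
          = ∑ i, l j * trace (c i * σ j) := by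
            refine Finset.sum_congr rfl fun i _ => ?_
            by_cases hi : μ i = 0
            · rw [mul_comm (c i), trace_mul_eq_zero_of_isSumSq_sub hc (hσ j) hpos (hsub j) hi]
              simp
            · field_simp
        _ = l j := by rw [← Finset.mul_sum, hc.sum_trace_mul (hσ j), mul_one]
    conv_rhs => rw [← h1]
    refine sum_mul_negMulLog_le (fun i _ => ?_) ?_ fun i _ => hμ i
    · exact mul_nonneg (mul_nonneg (hl j) (inv_nonneg.2 (hμ i)))
        (trace_mul_nonneg_of_primitive (hc.1 i) (hσ j))
    · simp only [mul_assoc]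
      rw [← Finset.mul_sum]
      exact mul_sum_inv_le_one hc (hσ j) hpos (hsub j)
  refine le_trans (le_of_eq ?_) (Finset.sum_le_sum fun j _ => hrow j)
  rw [Finset.sum_comm]
  refine Finset.sum_congr rfl fun i _ => ?_
  by_cases hi : μ i = 0
  · simp [hi]
  have h2 : ∑ j, l j * trace (c i * σ j) = μ i := by
    rw [← trace_sum_smul_mul hc μ i, h, Finset.sum_mul, trace_sum]
    exact Finset.sum_congr rfl fun j _ => by rw [smul_mul_assoc, trace_smul, mul_comm (c i)]
  rw [← Finset.sum_mul]
  have h3 : ∑ j, l j * (μ i)⁻¹ * trace (c i * σ j) = 1 := by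
    rw [← mul_inv_cancel₀ hi]
    conv_rhs => rw [← h2, Finset.sum_mul, h2]
    exact Finset.sum_congr rfl fun j _ => by ring
  rw [h3, one_mul]

theorem neg_sum_mul_log {n : ℕ} (l : Fin n → ℝ) :
    -∑ i, l i * Real.log (l i) = ∑ i, Real.negMulLog (l i) := by
  simp [Real.negMulLog]

theorem isLeast_spectrumEntropies {n : ℕ} {c : Fin n → A} (hc : IsFrame c) {μ : Fin n → ℝ}
    (hμ : ∀ i, 0 ≤ μ i) :
    IsLeast (spectrumEntropies (∑ i, μ i • c i)) (∑ i, Real.negMulLog (μ i)) := by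
  constructor
  · let π := Tuple.sort fun i => -μ i
    refine ⟨n, μ ∘ π, ⟨fun i j hij => ?_, fun i => hμ _, c ∘ π, fun i =>
      mem_pureStates_iff.2 (hc.1 _), ?_⟩, ?_⟩
    · exact neg_le_neg_iff.1 (Tuple.monotone_sort (fun i => -μ i) hij)
    · exact (Equiv.sum_comp π fun i => μ i • c i).symm
    · rw [neg_sum_mul_log]
      exact (Equiv.sum_comp π fun i => Real.negMulLog (μ i)).symm
  · rintro _ ⟨m, l, ⟨-, hl, σ, hσ, h⟩, rfl⟩
    rw [neg_sum_mul_log]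
    exact sum_negMulLog_le_of_primitive_decomposition hc hμ
      (fun j => mem_pureStates_iff.1 (hσ j)) hl h

/-- The matrix `trace (c i * d k)` between two frames is doubly stochastic: one marginal
redistributes `∑ η (μ i)`, the other permits Jensen's inequality. -/
theorem entropy_le_sum_negMulLog {x : A} (hx : IsSumSq x) {n : ℕ} {d : Fin n → A}
    (hd : IsFrame d) : entropy x ≤ ∑ k, Real.negMulLog (trace (x * d k)) := by
  obtain ⟨m, c, μ, hc, hμ, rfl⟩ := exists_nonneg_spectral_frame hx
  rw [entropy, (isLeast_spectrumEntropies hc hμ).csInf_eq]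
  calc ∑ i, Real.negMulLog (μ i)
      = ∑ i, ∑ k, trace (c i * d k) * Real.negMulLog (μ i) := by
        refine Finset.sum_congr rfl fun i _ => ?_
        rw [← Finset.sum_mul]
        simp only [mul_comm (c i)]
        rw [hd.sum_trace_mul (hc.1 i), one_mul]
    _ = ∑ k, ∑ i, trace (c i * d k) * Real.negMulLog (μ i) := Finset.sum_comm
    _ ≤ ∑ k, Real.negMulLog (∑ i, trace (c i * d k) * μ i) :=
        Finset.sum_le_sum fun k _ => sum_mul_negMulLog_le
          (fun i _ => trace_mul_nonneg_of_primitive (hc.1 i) (hd.1 k))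
          (hc.sum_trace_mul (hd.1 k)).le fun i _ => hμ i
    _ = ∑ k, Real.negMulLog (trace ((∑ i, μ i • c i) * d k)) := by
        refine Finset.sum_congr rfl fun k _ => ?_
        rw [Finset.sum_mul, trace_sum]
        congr 1
        exact Finset.sum_congr rfl fun i _ => by rw [smul_mul_assoc, trace_smul, mul_comm]

theorem concaveOn_entropy : ConcaveOn ℝ (positiveCone A) (entropy (A := A)) := by
  refine ⟨convex_positiveCone, fun x hx y hy a b ha hb hab => ?_⟩
  -- One frame serves `x` and `y` alike: the one diagonalizing the mixture, for which the upper
  -- bound is exact.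
  obtain ⟨n, d, ν, hd, hν, hz⟩ :=
    exists_nonneg_spectral_frame (convex_positiveCone hx hy ha hb hab)
  calc a • entropy x + b • entropy y
      ≤ a • ∑ k, Real.negMulLog (trace (x * d k)) + b • ∑ k, Real.negMulLog (trace (y * d k)) :=
        add_le_add (smul_le_smul_of_nonneg_left (entropy_le_sum_negMulLog hx hd) ha)
          (smul_le_smul_of_nonneg_left (entropy_le_sum_negMulLog hy hd) hb)
    _ = ∑ k, (a • Real.negMulLog (trace (x * d k)) + b • Real.negMulLog (trace (y * d k))) := by
        rw [Finset.smul_sum, Finset.smul_sum, Finset.sum_add_distrib]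
    _ ≤ ∑ k, Real.negMulLog (a • trace (x * d k) + b • trace (y * d k)) :=
        Finset.sum_le_sum fun k _ => Real.concaveOn_negMulLog.2
          (trace_mul_idempotent_nonneg hx (hd.1 k).2.1)
          (trace_mul_idempotent_nonneg hy (hd.1 k).2.1) ha hb hab
    _ = ∑ k, Real.negMulLog (ν k) := by
        refine Finset.sum_congr rfl fun k _ => ?_
        rw [← trace_sum_smul_mul hd ν k, ← hz, add_mul, trace_add, smul_mul_assoc, smul_mul_assoc,
          trace_smul, trace_smul, smul_eq_mul, smul_eq_mul]
    _ = entropy (a • x + b • y) := by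
        rw [hz, entropy, (isLeast_spectrumEntropies hd hν).csInf_eq]

end Entropy

end JordanEntropy

theorem mainTheorem2 {A : Type*} [NonUnitalNonAssocCommRing A] [Module ℝ A]
    [IsScalarTower ℝ A A] [SMulCommClass ℝ A A] [IsCommJordan A] [FiniteDimensional ℝ A]
    [IsFormallyReal A] :
    (∀ x ∈ JordanEntropy.positiveCone A,
      (JordanEntropy.spectrumEntropies x).Nonempty ∧
        BddBelow (JordanEntropy.spectrumEntropies x)) ∧
    ConcaveOn ℝ (JordanEntropy.positiveCone A) (JordanEntropy.entropy (A := A)) := by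
  refine ⟨fun x hx => ?_, JordanEntropy.concaveOn_entropy⟩
  obtain ⟨n, c, μ, hc, hμ, rfl⟩ := JordanEntropy.exists_nonneg_spectral_frame hx
  exact ⟨⟨_, (JordanEntropy.isLeast_spectrumEntropies hc hμ).1⟩,
    ⟨_, (JordanEntropy.isLeast_spectrumEntropies hc hμ).2⟩⟩
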